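/- Let $G=(V,E)$ be a finite simple undirected graph with $n(G)=|V|$ vertices and $m(G)=|E|$ edges. Let $\alpha(G)$ be the maximum size of an independent set of $G$ and $\mu(G)$ the maximum size of a matching of $G$; $G$ is called a König–Egerváry graph if $\alpha(G)+\mu(G)=n(G)$. For $A\subseteq V$ let $N(A)$ be the set of vertices having at least one neighbor in $A$, and let $d(G)=\max\{|A|-|N(A)| : A\subseteq V\}$. An independent set $S$ is critical if $|S|-|N(S)|=d(G)$. Let $\xi(G)=|\mathrm{core}(G)|$, where $\mathrm{core}(G)$ is the intersection of all maximum independent sets of $G$ (those of size $\alpha(G)$), and $\varepsilon(G)=|\ker(G)|$, where $\ker(G)$ is the intersection of all critical independent sets of $G$. Let $\varrho_v(G)$ be the number of vertices $v\in V$ such that $G-v$ (the subgraph induced by $V\setminus\{v\}$) is a König–Egerváry graph, and $\varrho_e(G)$ the number of edges $e\in E$ such that $G-e$ (the graph with vertex set $V$ and edge set $E\setminus\{e\}$) is a König–Egerváry graph. **Theorem.** If $G$ is a König–Egerváry graph, then $$n(G)-\varrho_v(G)\ \ge\ m(G)-\varrho_e(G).$$ Moreover, if $\xi(G)-\varepsilon(G)\le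 1$, then $n(G)-\varrho_v(G)=m(G)-\varrho_e(G)$. -/

import Mathlib

namespace SimpleGraph

variable {V : Type*}

/-- The matching number `μ(G)`: the largest number of edges of a matching of `G`. -/
noncomputable def matchingNumber (G : SimpleGraph V) : ℕ :=
  sSup {k | ∃ M : G.Subgraph, M.IsMatching ∧ M.edgeSet.ncard = k}

/-- `G` is a König–Egerváry graph: `α(G) + μ(G) = n(G)`. -/
def IsKonigEgervary (G : SimpleGraph V) : Prop :=
  G.indepNum + G.matchingNumber = Nat.card V

/-- The neighborhood `N(A)` of a set `A` of vertices: all vertices with a neighbor in `A`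
(it may meet `A`). -/
def setNeighborhood (G : SimpleGraph V) (A : Set V) : Set V :=
  {v | (G.neighborSet v ∩ A).Nonempty}

/-- The difference `d(A) = |A| - |N(A)|`, an integer. -/
noncomputable def difference (G : SimpleGraph V) (A : Set V) : ℤ :=
  (A.ncard : ℤ) - ((G.setNeighborhood A).ncard : ℤ)

/-- The critical difference `d(G)`: the maximum of `d(A)` over all sets `A` of vertices. -/
noncomputable def criticalDifference (G : SimpleGraph V) : ℤ :=
  ⨆ A : Set V, G.difference A

/-- On a finite vertex set the supremum defining `d(G)` is attained. -/
theorem criticalDifference_isGreatest [Finite V] (G : SimpleGraph V) :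
    IsGreatest (Set.range G.difference) G.criticalDifference :=
  ⟨(Set.range_nonempty G.difference).csSup_mem (Set.finite_range G.difference),
    fun _ h => le_csSup (Set.finite_range G.difference).bddAbove h⟩

/-- A critical independent set: an independent set `S` with `d(S) = d(G)`. -/
def IsCriticalIndepSet (G : SimpleGraph V) (S : Set V) : Prop :=
  G.IsIndepSet S ∧ G.difference S = G.criticalDifference

/-- `ker(G)`: the intersection of all critical independent sets. -/
def critKer (G : SimpleGraph V) : Set V :=
  ⋂₀ {S | G.IsCriticalIndepSet S}

/-- `core(G)`: the intersection of all maximum independent sets. -/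
def indepCore [Finite V] (G : SimpleGraph V) : Set V :=
  {v | ∀ S : Finset V, G.IsMaximumIndepSet S → v ∈ S}

/-- `ε(G) = |ker(G)|`. -/
noncomputable def kerCard (G : SimpleGraph V) : ℕ := G.critKer.ncard

/-- `ξ(G) = |core(G)|`. -/
noncomputable def coreCard [Finite V] (G : SimpleGraph V) : ℕ := G.indepCore.ncard

/-- `ϱ_v(G)`: the number of vertices `v` such that `G - v`, the subgraph induced by the
other vertices, is a König–Egerváry graph. -/
noncomputable def vertexHeredity (G : SimpleGraph V) : ℕ :=
  {v : V | (G.induce ({v}ᶜ : Set V)).IsKonigEgervary}.ncard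

/-- `ϱ_e(G)`: the number of edges `e` of `G` such that `G - e` is a König–Egerváry graph. -/
noncomputable def edgeHeredity (G : SimpleGraph V) : ℕ :=
  {e : Sym2 V | e ∈ G.edgeSet ∧ (G.deleteEdges {e}).IsKonigEgervary}.ncard

end SimpleGraph

/-!
For a König–Egerváry graph `G`, both sides of the inequality are governed by the set
`B = core(G) \ ker(G)`, which has `ξ(G) - ε(G)` elements: `n(G) - ϱ_v(G)` is the size of `B`, and
the edges counted by `m(G) - ϱ_e(G)` inject into `B`.

Matchings are encoded as involutions `f` of the vertex set (`IsPairing`), so that the missed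
vertices are the fixed points of `f`. Counting gives `|S| ≤ |Sᶜ| + |Fix f|` for independent `S`,
and `G` is a König–Egerváry graph exactly when equality occurs for some `S` and `f`, i.e. when some
matching sends every vertex outside some independent set `S` into `S` (`IsKECertificate`).
In that case every maximum independent set forms such a certificate with every maximum matching
(`IsKECertificate.exchange`).

* Vertices. `G - v` fails to be König–Egerváry iff `v` lies in every maximum independent set and is
  covered by every maximum matching. By Hall's theorem, a vertex covered by every maximum matching
  lies outside some critical independent set; conversely, a critical independent set contains all
  vertices missed by a maximum matching. Hence `ker(G)` is the set of vertices missed by some maximum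
  matching (`mem_critKer_iff`), and the vertices in question are those of `B`.
* Edges. If `G - xy` fails to be König–Egerváry, then `xy` lies in every maximum matching, and a
  second application of Hall's theorem shows that `x` or `y` lies in the core
  (`mem_indepCore_or_mem_indepCore`). So `xy` is the edge of a fixed maximum matching at a vertex of
  `B`, which gives the inequality.
* Equality. If `B = {v}`, then all maximum matchings give `v` the same partner `w`: the partner of
  `w` in any of them again belongs to `B`. As `v` lies in the core, deleting `vw` lowers the matching
  number without raising the independence number, so `vw` is an edge counted by `m(G) - ϱ_e(G)`.
-/

/-! ### Pairings of a vertex set -/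

namespace SimpleGraph

variable {V : Type*}

/-- A matching of `G`, encoded as the involution of the vertex set that swaps the two endpoints of
each edge of the matching and fixes every vertex that the matching misses. -/
structure IsPairing (G : SimpleGraph V) (f : V → V) : Prop where
  involutive : Function.Involutive f
  adj : ∀ v, f v ≠ v → G.Adj v (f v)

theorem Subgraph.IsMatching.two_mul_ncard_edgeSet [Finite V] {G : SimpleGraph V} {M : G.Subgraph}
    (hM : M.IsMatching) : 2 * M.edgeSet.ncard = M.verts.ncard := by
  classical
  have := Fintype.ofFinite V
  have h1 : M.edgeSet.ncard = M.coe.edgeSet.ncard := by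
    rw [← Subgraph.image_coe_edgeSet_coe,
      Set.ncard_image_of_injective _ (Sym2.map.injective Subtype.val_injective)]
  have h2 := M.coe.sum_degrees_eq_twice_card_edges
  have h3 : ∀ (v : M.verts) [Fintype (M.coe.neighborSet v)], M.coe.degree v = 1 := fun v _ => by
    rw [Subgraph.coe_degree]
    convert! (Subgraph.isMatching_iff_forall_degree.1 hM) v v.2
  simp only [h3] at h2
  rw [h1, Set.ncard_eq_toFinset_card', ← SimpleGraph.edgeFinset]
  simp only [Finset.sum_const, Finset.card_univ, smul_eq_mul, mul_one] at h2
  rw [← h2, ← Nat.card_eq_fintype_card, Nat.card_coe_set_eq]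

theorem Subgraph.IsMatching.exists_isPairing [Finite V] {G : SimpleGraph V} {M : G.Subgraph}
    (hM : M.IsMatching) :
    ∃ f, G.IsPairing f ∧ (Function.fixedPoints f).ncard + 2 * M.edgeSet.ncard = Nat.card V := by
  classical
  have hM' : ∀ v ∈ M.verts, ∃ w, M.Adj v w ∧ ∀ y, M.Adj v y → y = w := fun v hv => hM hv
  choose! p hp hu using hM'
  let f : V → V := fun v => if v ∈ M.verts then p v else v
  have hf : ∀ v ∈ M.verts, f v = p v := fun v hv => if_pos hv
  have hf' : ∀ v, v ∉ M.verts → f v = v := fun v hv => if_neg hv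
  refine ⟨f, ⟨fun v => ?_, fun v hv => ?_⟩, ?_⟩
  · by_cases h : v ∈ M.verts
    · have h' := M.edge_vert (hp v h).symm
      rw [hf v h, hf _ h']
      exact (hu _ h' _ (hp v h).symm).symm
    · rw [hf' v h, hf' v h]
  · by_cases h : v ∈ M.verts
    · rw [hf v h]
      exact M.adj_sub (hp v h)
    · exact absurd (hf' v h) hv
  · have : Function.fixedPoints f = M.vertsᶜ := by
      ext v
      constructor
      · intro hv hm
        have h1 : f v = v := hv
        have h2 := M.adj_sub (hp v hm)
        rw [← hf v hm, h1] at h2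
        exact h2.ne rfl
      · exact hf' v
    rw [this, hM.two_mul_ncard_edgeSet,
      add_comm, Set.ncard_add_ncard_compl]

namespace IsPairing

variable {G : SimpleGraph V} {f : V → V}

theorem exists_isMatching [Finite V] (hf : G.IsPairing f) :
    ∃ M : G.Subgraph, M.IsMatching ∧
      (Function.fixedPoints f).ncard + 2 * M.edgeSet.ncard = Nat.card V := by
  let M : G.Subgraph :=
    { verts := (Function.fixedPoints f)ᶜ
      Adj := fun u v => f u ≠ u ∧ f u = v
      adj_sub := by
        rintro u v ⟨h, rfl⟩
        exact hf.adj u h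
      edge_vert := fun h => h.1
      symm := ⟨by
        rintro u v ⟨h, rfl⟩
        exact ⟨by rw [hf.involutive u]; exact h.symm, hf.involutive u⟩⟩ }
  have hM : M.IsMatching := fun v hv => ⟨f v, ⟨hv, rfl⟩, fun w hw => hw.2.symm⟩
  refine ⟨M, hM, ?_⟩
  rw [hM.two_mul_ncard_edgeSet]
  exact Set.ncard_add_ncard_compl _

/-- If the partner of each matched vertex of `A` lies in `B`, then `|A| ≤ |B| + |A ∩ Fix f|`. -/
theorem ncard_le [Finite V] (hf : G.IsPairing f) {A B : Set V}
    (h : ∀ a ∈ A, f a ≠ a → f a ∈ B) :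
    A.ncard ≤ B.ncard + (A ∩ Function.fixedPoints f).ncard := by
  have h1 := Set.ncard_inter_add_ncard_sdiff_eq_ncard A (Function.fixedPoints f)
  have h2 : (f '' (A \ Function.fixedPoints f)).ncard ≤ B.ncard :=
    Set.ncard_le_ncard (by rintro _ ⟨a, ha, rfl⟩; exact h a ha.1 ha.2)
  rw [Set.ncard_image_of_injective _ hf.involutive.injective] at h2
  omega

/-- The case of equality in `IsPairing.ncard_le`. -/
theorem fixedPoints_subset_of_le [Finite V] (hf : G.IsPairing f) {A B : Set V}
    (h : ∀ a ∈ A, f a ≠ a → f a ∈ B)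
    (hle : B.ncard + (Function.fixedPoints f).ncard ≤ A.ncard) :
    Function.fixedPoints f ⊆ A ∧ ∀ b ∈ B, f b ∈ A := by
  have h1 := Set.ncard_inter_add_ncard_sdiff_eq_ncard A (Function.fixedPoints f)
  have hsub : f '' (A \ Function.fixedPoints f) ⊆ B := by
    rintro _ ⟨a, ha, rfl⟩
    exact h a ha.1 ha.2
  have h2 := Set.ncard_le_ncard hsub
  have h3 : (A ∩ Function.fixedPoints f).ncard ≤ (Function.fixedPoints f).ncard :=
    Set.ncard_le_ncard Set.inter_subset_right
  have hcard := Set.ncard_image_of_injective (A \ Function.fixedPoints f) hf.involutive.injective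
  constructor
  · have := Set.eq_of_subset_of_ncard_le
      (Set.inter_subset_right (s := A) (t := Function.fixedPoints f)) (by omega)
    exact Set.inter_eq_right.1 this
  · have := Set.eq_of_subset_of_ncard_le hsub (by omega)
    intro b hb
    rw [← this] at hb
    obtain ⟨a, ha, rfl⟩ := hb
    rw [hf.involutive a]
    exact ha.1

end IsPairing

theorem matchingNumber_isGreatest [Finite V] (G : SimpleGraph V) :
    IsGreatest {k | ∃ M : G.Subgraph, M.IsMatching ∧ M.edgeSet.ncard = k} G.matchingNumber := by
  have hb : BddAbove {k | ∃ M : G.Subgraph, M.IsMatching ∧ M.edgeSet.ncard = k} := by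
    refine ⟨Nat.card V, ?_⟩
    rintro _ ⟨M, hM, rfl⟩
    obtain ⟨f, -, h⟩ := hM.exists_isPairing
    omega
  refine ⟨Nat.sSup_mem ⟨_, ⊥, ?_, rfl⟩ hb, fun k hk => le_csSup hb hk⟩
  intro v hv
  simp at hv

theorem exists_isPairing_matchingNumber [Finite V] (G : SimpleGraph V) :
    ∃ f, G.IsPairing f ∧
      (Function.fixedPoints f).ncard + 2 * G.matchingNumber = Nat.card V := by
  obtain ⟨M, hM, h⟩ := (matchingNumber_isGreatest G).1
  rw [← h]
  exact hM.exists_isPairing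

theorem IsPairing.card_le [Finite V] {G : SimpleGraph V} {f : V → V} (hf : G.IsPairing f) :
    Nat.card V ≤ (Function.fixedPoints f).ncard + 2 * G.matchingNumber := by
  obtain ⟨M, hM, h⟩ := hf.exists_isMatching
  have := (matchingNumber_isGreatest G).2 ⟨M, hM, rfl⟩
  omega

end SimpleGraph

/-! ### Certificates of the König–Egerváry property -/

namespace SimpleGraph

variable {V : Type*} {G : SimpleGraph V}

/-- A certificate that `G` is a König–Egerváry graph: an independent set `S` together with a
matching, encoded as a pairing `f`, that matches every vertex outside `S` to a vertex of `S`. -/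
structure IsKECertificate (G : SimpleGraph V) (S : Set V) (f : V → V) : Prop where
  isIndepSet : G.IsIndepSet S
  isPairing : G.IsPairing f
  apply_mem : ∀ v, v ∉ S → f v ∈ S

theorem IsIndepSet.apply_mem_compl {S : Set V} {f : V → V} (hS : G.IsIndepSet S)
    (hf : G.IsPairing f) : ∀ a ∈ S, f a ≠ a → f a ∈ Sᶜ :=
  fun a ha hfa h => hS ha h hfa.symm (hf.adj a hfa)

theorem IsIndepSet.ncard_le [Finite V] {S : Set V} {f : V → V} (hS : G.IsIndepSet S)
    (hf : G.IsPairing f) : S.ncard ≤ Sᶜ.ncard + (Function.fixedPoints f).ncard := by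
  have h1 := hf.ncard_le (hS.apply_mem_compl hf)
  have h2 : (S ∩ Function.fixedPoints f).ncard ≤ (Function.fixedPoints f).ncard :=
    Set.ncard_le_ncard Set.inter_subset_right
  omega

namespace IsKECertificate

variable {S T : Set V} {f g : V → V}

theorem fixedPoints_subset (h : G.IsKECertificate S f) : Function.fixedPoints f ⊆ S := by
  intro v hv
  by_contra hS
  have h1 : f v = v := hv
  exact hS (h1 ▸ h.apply_mem v hS)

theorem adj (h : G.IsKECertificate S f) {v : V} (hv : v ∉ S) : G.Adj v (f v) :=
  h.isPairing.adj v fun h' => hv (h' ▸ h.apply_mem v hv)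

theorem apply_notMem (h : G.IsKECertificate S f) {v : V} (hv : v ∈ S) (hne : f v ≠ v) :
    f v ∉ S :=
  h.isIndepSet.apply_mem_compl h.isPairing v hv hne

variable [Finite V]

theorem ncard_eq (h : G.IsKECertificate S f) :
    Sᶜ.ncard + (Function.fixedPoints f).ncard = S.ncard := by
  refine le_antisymm ?_ (h.isIndepSet.ncard_le h.isPairing)
  have hd : Disjoint (f '' Sᶜ) (Function.fixedPoints f) := by
    rw [Set.disjoint_left]
    rintro _ ⟨u, hu, rfl⟩ h2
    have h3 : f u = u := h.isPairing.involutive.injective h2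
    exact hu (h3 ▸ h.apply_mem u hu)
  rw [← Set.ncard_image_of_injective Sᶜ h.isPairing.involutive.injective,
    ← Set.ncard_union_eq hd]
  refine Set.ncard_le_ncard (Set.union_subset ?_ h.fixedPoints_subset)
  rintro _ ⟨u, hu, rfl⟩
  exact h.apply_mem u hu

theorem of_ncard_le (hS : G.IsIndepSet S) (hf : G.IsPairing f)
    (h : Sᶜ.ncard + (Function.fixedPoints f).ncard ≤ S.ncard) : G.IsKECertificate S f :=
  ⟨hS, hf, (hf.fixedPoints_subset_of_le (hS.apply_mem_compl hf) h).2⟩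

theorem two_mul_ncard (h : G.IsKECertificate S f) :
    2 * S.ncard = Nat.card V + (Function.fixedPoints f).ncard := by
  have h1 := h.ncard_eq
  have h2 := Set.ncard_add_ncard_compl S
  omega

/-- The independent set of a certificate is a maximum one. -/
theorem ncard_le (h : G.IsKECertificate S f) (hT : G.IsIndepSet T) : T.ncard ≤ S.ncard := by
  have h1 := h.two_mul_ncard
  have h2 := Set.ncard_add_ncard_compl T
  have h3 := hT.ncard_le h.isPairing
  omega

theorem of_isIndepSet (h : G.IsKECertificate S f) (hT : G.IsIndepSet T)
    (hle : S.ncard ≤ T.ncard) : G.IsKECertificate T f := by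
  have h1 := h.two_mul_ncard
  have h2 := Set.ncard_add_ncard_compl T
  exact of_ncard_le hT h.isPairing (by omega)

theorem of_isPairing (h : G.IsKECertificate S f) (hg : G.IsPairing g)
    (hle : (Function.fixedPoints g).ncard ≤ (Function.fixedPoints f).ncard) :
    G.IsKECertificate S g := by
  have h1 := h.ncard_eq
  exact of_ncard_le h.isIndepSet hg (by omega)

/-- The two halves of a certificate can be chosen independently of each other: every maximum
independent set goes with every maximum matching. -/
theorem exchange (h : G.IsKECertificate S f) (h' : G.IsKECertificate T g) :
    G.IsKECertificate S g :=
  h'.of_isIndepSet h.isIndepSet (h.ncard_le h'.isIndepSet)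

theorem exists_isMaximumIndepSet (h : G.IsKECertificate S f) :
    ∃ s : Finset V, (s : Set V) = S ∧ G.IsMaximumIndepSet s := by
  refine ⟨S.toFinite.toFinset, by simp, ⟨by simpa using h.isIndepSet, fun t ht => ?_⟩⟩
  rw [← Set.ncard_eq_toFinset_card S, ← Set.ncard_coe_finset]
  exact h.ncard_le ht

theorem ncard_eq_indepNum (h : G.IsKECertificate S f) : S.ncard = G.indepNum := by
  obtain ⟨s, rfl, hs⟩ := h.exists_isMaximumIndepSet
  rw [Set.ncard_coe_finset, maximumIndepSet_card_eq_indepNum s hs]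

end IsKECertificate

theorem isKonigEgervary_iff_exists_isKECertificate [Finite V] :
    G.IsKonigEgervary ↔ ∃ S f, G.IsKECertificate S f := by
  obtain ⟨f, hf, hc⟩ := G.exists_isPairing_matchingNumber
  constructor
  · intro h
    obtain ⟨s, hs⟩ := G.exists_isNIndepSet_indepNum
    refine ⟨s, f, .of_ncard_le hs.isIndepSet hf ?_⟩
    have h1 := Set.ncard_add_ncard_compl (s : Set V)
    have h2 : (s : Set V).ncard = G.indepNum := by rw [Set.ncard_coe_finset, hs.card_eq]
    have h3 : G.indepNum + G.matchingNumber = Nat.card V := h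
    omega
  · rintro ⟨S, g, h⟩
    have h1 := h.ncard_eq_indepNum
    have h2 := h.two_mul_ncard
    have h3 := h.isPairing.card_le
    have h4 := Set.ncard_add_ncard_compl S
    have h5 := h.isIndepSet.ncard_le hf
    show G.indepNum + G.matchingNumber = Nat.card V
    omega

theorem mem_indepCore_iff [Finite V] (hG : G.IsKonigEgervary) {v : V} :
    v ∈ G.indepCore ↔ ∀ S f, G.IsKECertificate S f → v ∈ S := by
  constructor
  · intro hv S f h
    obtain ⟨s, rfl, hs⟩ := h.exists_isMaximumIndepSet
    exact hv s hs
  · intro hv s hs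
    obtain ⟨S, f, h⟩ := isKonigEgervary_iff_exists_isKECertificate.1 hG
    refine hv s f (h.of_isIndepSet hs.isIndepSet ?_)
    rw [Set.ncard_coe_finset, maximumIndepSet_card_eq_indepNum s hs, h.ncard_eq_indepNum]

/-- An injection of the complement of an independent set into it, along edges, is a matching. -/
theorem IsIndepSet.exists_isKECertificate_of_injOn {S : Set V} (hS : G.IsIndepSet S) {g : V → V}
    (hg : Set.InjOn g Sᶜ) (hmem : ∀ u, u ∉ S → g u ∈ S) (hadj : ∀ u, u ∉ S → G.Adj u (g u)) :
    ∃ f, G.IsKECertificate S f ∧ ∀ u, u ∉ S → f u = g u := by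
  classical
  let f : V → V := fun v =>
    if v ∉ S then g v else if h : ∃ u, u ∉ S ∧ g u = v then h.choose else v
  have h1 : ∀ v, v ∉ S → f v = g v := fun v hv => if_pos hv
  have h2 : ∀ v, v ∉ S → f (g v) = v := by
    intro v hv
    have hex : ∃ u, u ∉ S ∧ g u = g v := ⟨v, hv, rfl⟩
    have : f (g v) = hex.choose := by simp only [f]; rw [if_neg (not_not.2 (hmem v hv)), dif_pos hex]
    rw [this]
    exact hg hex.choose_spec.1 hv hex.choose_spec.2
  have h3 : ∀ v, v ∈ S → (¬ ∃ u, u ∉ S ∧ g u = v) → f v = v := by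
    intro v hv hne
    simp only [f]
    rw [if_neg (not_not.2 hv), dif_neg hne]
  refine ⟨f, ⟨hS, ⟨fun v => ?_, fun v hv => ?_⟩, fun v hv => ?_⟩, h1⟩
  · by_cases hv : v ∈ S
    · by_cases hex : ∃ u, u ∉ S ∧ g u = v
      · obtain ⟨u, hu, rfl⟩ := hex
        rw [h2 u hu, h1 u hu]
      · rw [h3 v hv hex, h3 v hv hex]
    · rw [h1 v hv, h2 v hv]
  · by_cases hvS : v ∈ S
    · by_cases hex : ∃ u, u ∉ S ∧ g u = v
      · obtain ⟨u, hu, rfl⟩ := hex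
        rw [h2 u hu]
        exact (hadj u hu).symm
      · exact absurd (h3 v hvS hex) hv
    · rw [h1 v hvS]
      exact hadj v hvS
  · rw [h1 v hv]
    exact hmem v hv

/-- Hall's theorem for a relation on a finite set, with the deficient set as the alternative. -/
theorem exists_injOn_or_exists_ncard_lt [Finite V] (C : Set V) (r : V → V → Prop) :
    (∃ g : V → V, Set.InjOn g C ∧ ∀ u ∈ C, r u (g u)) ∨
      ∃ T ⊆ C, {w | ∃ u ∈ T, r u w}.ncard < T.ncard := by
  classical
  have := Fintype.ofFinite V
  rw [or_iff_not_imp_right]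
  intro hT
  push Not at hT
  obtain ⟨g, hg, hr⟩ := (Fintype.all_card_le_filter_rel_iff_exists_injective
    (fun (u : C) w => r u w)).1 fun A => by
      have h1 := hT (Subtype.val '' (A : Set C)) (by rintro _ ⟨a, -, rfl⟩; exact a.2)
      rw [Set.ncard_image_of_injective _ Subtype.val_injective, Set.ncard_coe_finset] at h1
      refine h1.trans_eq ?_
      rw [← Set.ncard_coe_finset]
      congr 1
      ext w
      simp
  refine ⟨fun v => if h : v ∈ C then g ⟨v, h⟩ else v, fun a ha b hb hab => ?_, fun u hu => ?_⟩
  · simp only [dif_pos ha, dif_pos hb] at hab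
    exact congrArg Subtype.val (hg hab)
  · simp only [dif_pos hu]
    exact hr ⟨u, hu⟩

end SimpleGraph

/-! ### Critical independent sets -/

namespace SimpleGraph

variable {V : Type*} {G : SimpleGraph V}

theorem IsPairing.apply_mem_setNeighborhood {f : V → V} (hf : G.IsPairing f) (A : Set V) :
    ∀ a ∈ A, f a ≠ a → f a ∈ G.setNeighborhood A :=
  fun a ha hfa => ⟨a, (hf.adj a hfa).symm, ha⟩

namespace IsKECertificate

variable {S A : Set V} {f : V → V}

theorem setNeighborhood_subset_compl (h : G.IsKECertificate S f) :
    G.setNeighborhood S ⊆ Sᶜ := by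
  rintro v ⟨u, huv, hu⟩ hv
  exact h.isIndepSet hv hu (G.ne_of_adj huv) huv

variable [Finite V]

theorem criticalDifference_eq (h : G.IsKECertificate S f) :
    G.criticalDifference = ((Function.fixedPoints f).ncard : ℤ) := by
  refine le_antisymm ?_ ?_
  · obtain ⟨A, hA⟩ := (criticalDifference_isGreatest G).1
    rw [← hA, difference]
    have h1 := h.isPairing.ncard_le (h.isPairing.apply_mem_setNeighborhood A)
    have h2 : (A ∩ Function.fixedPoints f).ncard ≤ (Function.fixedPoints f).ncard :=
      Set.ncard_le_ncard Set.inter_subset_right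
    omega
  · refine le_trans ?_ ((criticalDifference_isGreatest G).2 ⟨S, rfl⟩)
    rw [difference]
    have h1 := h.ncard_eq
    have h2 := Set.ncard_le_ncard h.setNeighborhood_subset_compl
    omega

theorem isCriticalIndepSet_of_le (h : G.IsKECertificate S f) (hA : G.IsIndepSet A)
    (hle : (G.setNeighborhood A).ncard + (Function.fixedPoints f).ncard ≤ A.ncard) :
    G.IsCriticalIndepSet A := by
  refine ⟨hA, le_antisymm ((criticalDifference_isGreatest G).2 ⟨A, rfl⟩) ?_⟩
  rw [h.criticalDifference_eq, difference]
  omega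

theorem isCriticalIndepSet (h : G.IsKECertificate S f) : G.IsCriticalIndepSet S := by
  refine h.isCriticalIndepSet_of_le h.isIndepSet ?_
  have h1 := h.ncard_eq
  have h2 := Set.ncard_le_ncard h.setNeighborhood_subset_compl
  omega

/-- A critical independent set contains every vertex that some maximum matching misses, and every
maximum matching matches its neighborhood into it. -/
theorem fixedPoints_subset_of_isCriticalIndepSet (h : G.IsKECertificate S f)
    (hA : G.IsCriticalIndepSet A) :
    Function.fixedPoints f ⊆ A ∧ ∀ b ∈ G.setNeighborhood A, f b ∈ A := by
  refine h.isPairing.fixedPoints_subset_of_le (h.isPairing.apply_mem_setNeighborhood A) ?_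
  have h1 := hA.2
  rw [h.criticalDifference_eq, difference] at h1
  omega

/-- A vertex that every maximum matching covers lies outside some critical independent set. -/
theorem exists_isCriticalIndepSet_notMem (h : G.IsKECertificate S f) {v : V}
    (hv : ∀ T g, G.IsKECertificate T g → g v ≠ v) :
    ∃ A, G.IsCriticalIndepSet A ∧ v ∉ A := by
  by_cases hvS : v ∈ S
  swap
  · exact ⟨S, h.isCriticalIndepSet, hvS⟩
  -- A matching of the complement of `S` into `S \ {v}` would miss `v`, so Hall's condition fails.
  rcases exists_injOn_or_exists_ncard_lt Sᶜ (fun u w => G.Adj u w ∧ w ∈ S ∧ w ≠ v) with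
    ⟨g, hg, hr⟩ | ⟨T, hTS, hT⟩
  · obtain ⟨f', hf', hfg⟩ := h.isIndepSet.exists_isKECertificate_of_injOn hg
      (fun u hu => (hr u hu).2.1) (fun u hu => (hr u hu).1)
    have h1 := hf'.apply_notMem hvS (hv S f' hf')
    have h2 := hfg _ h1
    rw [hf'.isPairing.involutive v] at h2
    exact absurd h2.symm (hr _ h1).2.2
  · let K : Set V := {w | w ∈ S ∧ ∃ u ∈ T, G.Adj u w}
    have hTK : T.ncard ≤ K.ncard := by
      rw [← Set.ncard_image_of_injective T h.isPairing.involutive.injective]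
      refine Set.ncard_le_ncard ?_
      rintro _ ⟨u, hu, rfl⟩
      exact ⟨h.apply_mem u (hTS hu), u, hu, h.adj (hTS hu)⟩
    have hKv : K ⊆ insert v {w | ∃ u ∈ T, G.Adj u w ∧ w ∈ S ∧ w ≠ v} := by
      rintro w ⟨hw, u, hu, huw⟩
      by_cases hwv : w = v
      · exact Or.inl hwv
      · exact Or.inr ⟨u, hu, huw, hw, hwv⟩
    have hKT : K.ncard ≤ T.ncard :=
      (Set.ncard_le_ncard hKv).trans ((Set.ncard_insert_le _ _).trans hT)
    have hvK : v ∈ K := by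
      by_contra hvK
      have := Set.ncard_le_ncard ((Set.subset_insert_iff_of_notMem hvK).1 hKv)
      omega
    refine ⟨S \ K, h.isCriticalIndepSet_of_le (h.isIndepSet.mono Set.sdiff_subset) ?_,
      fun hmem => hmem.2 hvK⟩
    have hN : G.setNeighborhood (S \ K) ⊆ Sᶜ \ T := by
      rintro x ⟨w, hxw, hw, hwK⟩
      exact ⟨h.setNeighborhood_subset_compl ⟨w, hxw, hw⟩, fun hx => hwK ⟨hw, x, hx, hxw⟩⟩
    have h1 := Set.ncard_le_ncard hN
    have h2 := Set.ncard_sdiff_add_ncard_of_subset hTS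
    have h3 := Set.ncard_sdiff_add_ncard_of_subset (s := K) (t := S) (fun w hw => hw.1)
    have h4 := h.ncard_eq
    omega

end IsKECertificate

theorem mem_critKer_iff [Finite V] (hG : G.IsKonigEgervary) {v : V} :
    v ∈ G.critKer ↔ ∃ S f, G.IsKECertificate S f ∧ f v = v := by
  obtain ⟨S, f, h⟩ := isKonigEgervary_iff_exists_isKECertificate.1 hG
  constructor
  · intro hv
    by_contra! hne
    obtain ⟨A, hA, hvA⟩ := h.exists_isCriticalIndepSet_notMem hne
    exact hvA (hv A hA)
  · rintro ⟨T, g, h', hgv⟩ A hA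
    exact (h'.fixedPoints_subset_of_isCriticalIndepSet hA).1 hgv

theorem critKer_subset_indepCore [Finite V] (hG : G.IsKonigEgervary) :
    G.critKer ⊆ G.indepCore := fun _ hv =>
  (mem_indepCore_iff hG).2 fun S _ h => hv S h.isCriticalIndepSet

/-! ### Deleting a vertex -/

/-- A certificate for `G - v`, read in `G`. -/
theorem isKonigEgervary_induce_compl_iff [Finite V] {v : V} :
    (G.induce ({v}ᶜ : Set V)).IsKonigEgervary ↔
      ∃ S f, G.IsIndepSet S ∧ G.IsPairing f ∧ v ∉ S ∧ f v = v ∧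
        ∀ u, u ≠ v → u ∉ S → f u ∈ S := by
  classical
  rw [isKonigEgervary_iff_exists_isKECertificate]
  constructor
  · rintro ⟨S, f, h⟩
    let F : V → V := fun u => if hu : u ∈ ({v}ᶜ : Set V) then f ⟨u, hu⟩ else u
    have hF : ∀ u : ({v}ᶜ : Set V), F u = f u := fun u => dif_pos u.2
    have hFv : F v = v := dif_neg (fun h => h rfl)
    refine ⟨Subtype.val '' S, F, ?_, ⟨fun u => ?_, fun u hu => ?_⟩, ?_, hFv, fun u hu huS => ?_⟩
    · rintro _ ⟨a, ha, rfl⟩ _ ⟨b, hb, rfl⟩ hab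
      exact h.isIndepSet ha hb (fun h => hab (congrArg _ h))
    · by_cases huv : u = v
      · rw [huv, hFv, hFv]
      · rw [hF ⟨u, huv⟩, hF, h.isPairing.involutive]
    · by_cases huv : u = v
      · exact absurd (huv ▸ hFv) hu
      · have h1 := hF ⟨u, huv⟩
        simp only at h1
        rw [h1] at hu ⊢
        exact h.isPairing.adj ⟨u, huv⟩ fun h2 => hu (congrArg _ h2)
    · rintro ⟨a, -, ha⟩
      exact a.2 ha
    · rw [hF ⟨u, hu⟩]
      exact ⟨_, h.apply_mem ⟨u, hu⟩ fun h' => huS ⟨_, h', rfl⟩, rfl⟩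
  · rintro ⟨S, f, hS, hf, hvS, hfv, h⟩
    have hne : ∀ u : ({v}ᶜ : Set V), f u ∈ ({v}ᶜ : Set V) := fun u hu =>
      u.2 (hf.involutive.injective (Eq.trans hu hfv.symm))
    refine ⟨Subtype.val ⁻¹' S, fun u => ⟨f u, hne u⟩, ?_, ⟨fun u => ?_, fun u hu => ?_⟩,
      fun u hu => h u u.2 hu⟩
    · intro a ha b hb hab
      exact hS ha hb (fun h => hab (Subtype.ext h))
    · exact Subtype.ext (hf.involutive u)
    · exact hf.adj u fun h' => hu (Subtype.ext h')

/-- For a König–Egerváry graph `G`, the graph `G - v` fails to be one exactly when deleting `v`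
lowers both the independence number and the matching number. -/
theorem isKonigEgervary_induce_compl_iff_notMem [Finite V] (hG : G.IsKonigEgervary) {v : V} :
    (G.induce ({v}ᶜ : Set V)).IsKonigEgervary ↔ v ∉ G.indepCore \ G.critKer := by
  classical
  rw [isKonigEgervary_induce_compl_iff, Set.mem_sdiff, mem_indepCore_iff hG, mem_critKer_iff hG]
  constructor
  · rintro ⟨S, f, hS, hf, hvS, hfv, h⟩ ⟨hcore, hker⟩
    obtain ⟨T, g, hT⟩ := isKonigEgervary_iff_exists_isKECertificate.1 hG
    have hlt : S.ncard < T.ncard := by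
      by_contra! hle
      exact hvS (hcore S g (hT.of_isIndepSet hS hle))
    -- Apart from `v`, the pairing `f` misses only vertices of `S`, so it is a maximum matching.
    refine hker ⟨T, f, hT.of_isPairing hf ?_, hfv⟩
    have hdisj : Disjoint (f '' (Sᶜ \ {v})) (Function.fixedPoints f \ {v}) := by
      rw [Set.disjoint_left]
      rintro _ ⟨u, ⟨huS, huv⟩, rfl⟩ ⟨h2, -⟩
      have h3 : f u = u := hf.involutive.injective h2
      exact huS (h3 ▸ h u huv huS)
    have hsub : f '' (Sᶜ \ {v}) ∪ (Function.fixedPoints f \ {v}) ⊆ S := by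
      rintro w (⟨u, ⟨huS, huv⟩, rfl⟩ | ⟨hw, hwv⟩)
      · exact h u huv huS
      · by_contra hwS
        have h3 : f w = w := hw
        exact hwS (h3 ▸ h w hwv hwS)
    have h1 := Set.ncard_le_ncard hsub
    rw [Set.ncard_union_eq hdisj, Set.ncard_image_of_injective _ hf.involutive.injective] at h1
    have h2 := Set.ncard_sdiff_singleton_add_one (s := Sᶜ) (a := v) hvS
    have h3 := Set.ncard_sdiff_singleton_add_one (s := Function.fixedPoints f) (a := v) hfv
    have h4 := Set.ncard_add_ncard_compl S
    have h5 := hT.two_mul_ncard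
    omega
  · intro hv
    rw [not_and_or, not_not] at hv
    rcases hv with hv | ⟨S, f, h, hfv⟩
    · push Not at hv
      obtain ⟨S, f, h, hvS⟩ := hv
      -- Unmatch `v` and its partner, which lies in `S`.
      have hfvS := h.apply_mem v hvS
      refine ⟨S, fun u => if u = v ∨ u = f v then u else f u, h.isIndepSet, ⟨fun u => ?_,
        fun u hu => ?_⟩, hvS, by simp, fun u hu huS => ?_⟩
      · by_cases hu : u = v ∨ u = f v
        · simp [hu]
        · have : ¬ (f u = v ∨ f u = f v) := by
            rintro (h' | h')
            · exact hu (Or.inr (by rw [← h', h.isPairing.involutive]))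
            · exact hu (Or.inl (h.isPairing.involutive.injective h'))
          simp only [if_neg hu, if_neg this]
          exact h.isPairing.involutive u
      · by_cases hu' : u = v ∨ u = f v
        · simp [hu'] at hu
        · simp only [if_neg hu'] at hu ⊢
          exact h.isPairing.adj u hu
      · have : ¬ (u = v ∨ u = f v) := by
          rintro (h' | h')
          · exact hu h'
          · exact huS (h' ▸ hfvS)
        simp only [if_neg this]
        exact h.apply_mem u huS
    · refine ⟨S \ {v}, f, h.isIndepSet.mono Set.sdiff_subset, h.isPairing, fun h' => h'.2 rfl, hfv,
        fun u hu huS => ?_⟩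
      have huS' : u ∉ S := fun h' => huS ⟨h', hu⟩
      exact ⟨h.apply_mem u huS', fun h' => hu (h.isPairing.involutive.injective (h'.trans hfv.symm))⟩

end SimpleGraph

/-! ### Deleting an edge -/

namespace SimpleGraph

variable {V : Type*} [Finite V] {G : SimpleGraph V}

/-- If `G - xy` is not a König–Egerváry graph, then `xy` lies in every maximum matching of `G`. -/
theorem IsKECertificate.apply_eq_of_not_isKonigEgervary {S : Set V} {f : V → V}
    (h : G.IsKECertificate S f) {x y : V}
    (hxy : ¬ (G.deleteEdges {s(x, y)}).IsKonigEgervary) : f x = y := by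
  by_contra hne
  refine hxy (isKonigEgervary_iff_exists_isKECertificate.2 ⟨S, f, ?_, ⟨h.isPairing.involutive,
    fun v hv => ?_⟩, h.apply_mem⟩)
  · exact fun a ha b hb hab hadj => h.isIndepSet ha hb hab (deleteEdges_adj.1 hadj).1
  · refine deleteEdges_adj.2 ⟨h.isPairing.adj v hv, fun he => ?_⟩
    rcases Sym2.eq_iff.1 he with ⟨rfl, h'⟩ | ⟨rfl, h'⟩
    · exact hne h'
    · exact hne (by rw [← h', h.isPairing.involutive])

/-- If `G - xy` is not a König–Egerváry graph, then an endpoint of `xy` lies in every maximum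
independent set of `G`. Otherwise there are maximum independent sets `S ∌ y` and `S' ∌ x`; the
failure of Hall's condition in `G - xy` gives a union `R` of matched pairs, containing `xy`, such
that `S` may be replaced by `S'` on `R`, and `x` may then be added once `xy` is deleted. -/
theorem mem_indepCore_or_mem_indepCore (hG : G.IsKonigEgervary) {x y : V}
    (hxy : ¬ (G.deleteEdges {s(x, y)}).IsKonigEgervary) :
    x ∈ G.indepCore ∨ y ∈ G.indepCore := by
  by_contra! hcon
  rw [mem_indepCore_iff hG, mem_indepCore_iff hG] at hcon
  push Not at hcon
  obtain ⟨⟨S', g, h', hx⟩, S, f, h, hy⟩ := hcon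
  replace h' := h'.exchange h
  have hinv := h.isPairing.involutive
  have hfx : f x = y := h.apply_eq_of_not_isKonigEgervary hxy
  have hfy : f y = x := by rw [← hfx, hinv]
  have hxS : x ∈ S := hfy ▸ h.apply_mem y hy
  have hyS' : y ∈ S' := hfx ▸ h'.apply_mem x hx
  rcases exists_injOn_or_exists_ncard_lt Sᶜ
    (fun u w => G.Adj u w ∧ w ∈ S ∧ ¬ (u = y ∧ w = x)) with ⟨k, hk, hr⟩ | ⟨T, hTS, hT⟩
  · obtain ⟨f', hf', hfk⟩ := h.isIndepSet.exists_isKECertificate_of_injOn hk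
      (fun u hu => (hr u hu).2.1) (fun u hu => (hr u hu).1)
    have h1 := hf'.apply_eq_of_not_isKonigEgervary hxy
    refine (hr y hy).2.2 ⟨rfl, ?_⟩
    rw [← hfk y hy, ← h1, hf'.isPairing.involutive]
  · set N : Set V := {w | ∃ u ∈ T, G.Adj u w ∧ w ∈ S ∧ ¬ (u = y ∧ w = x)} with hN
    have hsub : f '' (T \ {y}) ⊆ N := by
      rintro _ ⟨u, ⟨hu, huy⟩, rfl⟩
      exact ⟨u, hu, h.adj (hTS hu), h.apply_mem u (hTS hu), fun hc => huy hc.1⟩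
    have hcard := Set.ncard_le_ncard hsub
    rw [Set.ncard_image_of_injective _ hinv.injective] at hcard
    have hyT : y ∈ T := by
      by_contra hyT
      rw [Set.sdiff_singleton_eq_self hyT] at hcard
      omega
    have hNT : f '' (T \ {y}) = N := by
      refine Set.eq_of_subset_of_ncard_le hsub ?_
      rw [Set.ncard_image_of_injective _ hinv.injective]
      have := Set.ncard_sdiff_singleton_add_one hyT
      omega
    have hxN : x ∉ N := by
      rw [← hNT]
      rintro ⟨u, ⟨-, huy⟩, hu⟩
      exact huy (hinv.injective (hu.trans hfy.symm))
    have hfTS : f '' T ⊆ S := by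
      rintro _ ⟨u, hu, rfl⟩
      exact h.apply_mem u (hTS hu)
    have hnbr : ∀ w ∈ S, ∀ u ∈ T, G.Adj u w → w ∈ f '' T := by
      intro w hw u hu huw
      by_cases hc : u = y ∧ w = x
      · exact ⟨y, hyT, hc.2 ▸ hfy⟩
      · have hwN : w ∈ N := ⟨u, hu, huw, hw, hc⟩
        rw [← hNT] at hwN
        exact Set.image_mono Set.sdiff_subset hwN
    let R : Set V := T ∪ f '' T
    have hR : ∀ u, f u ∈ R → u ∈ R := by
      rintro u (hu | ⟨t, ht, htu⟩)
      · exact Or.inr ⟨f u, hu, hinv u⟩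
      · exact Or.inl (hinv.injective htu ▸ ht)
    have hR' : ∀ u, u ∈ R → f u ∈ R := fun u hu => hR (f u) (by rwa [hinv u])
    let U : Set V := (S \ R) ∪ (S' ∩ R)
    have hcross : ∀ a ∈ S \ R, ∀ b ∈ S' ∩ R, ¬ G.Adj a b := by
      rintro a ⟨ha, haR⟩ b ⟨-, hb | hb⟩ hab
      · exact haR (Or.inr (hnbr a ha b hb hab.symm))
      · exact h.isIndepSet ha (hfTS hb) hab.ne hab
    have hU : ∀ a ∈ U, ∀ b ∈ U, ¬ G.Adj a b := by
      rintro a (ha | ha) b (hb | hb) hab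
      · exact h.isIndepSet ha.1 hb.1 hab.ne hab
      · exact hcross a ha b hb hab
      · exact hcross b hb a ha hab.symm
      · exact h'.isIndepSet ha.1 hb.1 hab.ne hab
    have hxU : ∀ b ∈ U, b ≠ y → ¬ G.Adj x b := by
      rintro b (hb | ⟨-, hb | hb⟩) hby hxb
      · exact h.isIndepSet hxS hb.1 hxb.ne hxb
      · exact hxN ⟨b, hb, hxb.symm, hxS, fun hc => hby hc.1⟩
      · exact h.isIndepSet hxS (hfTS hb) hxb.ne hxb
    have hfU : ∀ u, u ∉ U → f u ∈ U := by
      intro u hu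
      by_cases huR : u ∈ R
      · exact Or.inr ⟨h'.apply_mem u fun hu' => hu (Or.inr ⟨hu', huR⟩), hR' u huR⟩
      · exact Or.inl ⟨h.apply_mem u fun hu' => hu (Or.inl ⟨hu', huR⟩), fun hf => huR (hR u hf)⟩
    have hyU : y ∈ U := Or.inr ⟨hyS', Or.inl hyT⟩
    have hind : (G.deleteEdges {s(x, y)}).IsIndepSet (insert x U) := by
      rintro a (rfl | ha) b (rfl | hb) hab hadj
      · exact hab rfl
      · obtain ⟨h1, h2⟩ := deleteEdges_adj.1 hadj
        exact hxU b hb (fun hby => h2 (by rw [hby]; rfl)) h1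
      · obtain ⟨h1, h2⟩ := deleteEdges_adj.1 hadj
        exact hxU a ha (fun hay => h2 (by rw [hay, Sym2.eq_swap]; rfl)) h1.symm
      · exact hU a ha b hb (deleteEdges_adj.1 hadj).1
    obtain ⟨k, hk, -⟩ := hind.exists_isKECertificate_of_injOn (g := f) hinv.injective.injOn
      (fun u hu => Or.inr (hfU u fun h => hu (Or.inr h))) (fun u hu => by
        refine deleteEdges_adj.2 ⟨h.isPairing.adj u fun hfu => ?_, fun he => ?_⟩
        · exact hu (Or.inr (hfu ▸ hfU u fun h => hu (Or.inr h)))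
        · rcases Sym2.eq_iff.1 he with ⟨rfl, -⟩ | ⟨rfl, -⟩
          · exact hu (Or.inl rfl)
          · exact hu (Or.inr hyU))
    exact hxy (isKonigEgervary_iff_exists_isKECertificate.2 ⟨_, _, hk⟩)

/-- Every edge whose deletion destroys the König–Egerváry property is the edge of any prescribed
maximum matching at some vertex of `core(G) \ ker(G)`. -/
theorem IsKECertificate.setOf_not_isKonigEgervary_subset {S : Set V} {f : V → V}
    (h : G.IsKECertificate S f) :
    {e | e ∈ G.edgeSet ∧ ¬ (G.deleteEdges {e}).IsKonigEgervary} ⊆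
      (fun v => s(v, f v)) '' (G.indepCore \ G.critKer) := by
  have hG : G.IsKonigEgervary := isKonigEgervary_iff_exists_isKECertificate.2 ⟨S, f, h⟩
  have key : ∀ x y, G.Adj x y → ¬ (G.deleteEdges {s(x, y)}).IsKonigEgervary →
      x ∈ G.indepCore → s(x, y) ∈ (fun v => s(v, f v)) '' (G.indepCore \ G.critKer) := by
    intro x y hadj hxy hx
    refine ⟨x, ⟨hx, fun hker => ?_⟩, by simp only [h.apply_eq_of_not_isKonigEgervary hxy]⟩
    obtain ⟨T, g, hT, hgx⟩ := (mem_critKer_iff hG).1 hker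
    exact hadj.ne (hgx.symm.trans (hT.apply_eq_of_not_isKonigEgervary hxy))
  rintro ⟨x, y⟩ ⟨hadj, hxy⟩
  change ¬ (G.deleteEdges {s(x, y)}).IsKonigEgervary at hxy
  change G.Adj x y at hadj
  change s(x, y) ∈ _
  rcases mem_indepCore_or_mem_indepCore hG hxy with hx | hy
  · exact key x y hadj hxy hx
  · rw [Sym2.eq_swap] at hxy ⊢
    exact key y x hadj.symm hxy hy

/-- If `core(G) \ ker(G)` consists of `v` alone, then every maximum matching gives `v` the same
partner `w`. -/
theorem IsKECertificate.apply_apply_eq_of_forall_eq {S T : Set V} {f g : V → V}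
    (h : G.IsKECertificate S f) (h' : G.IsKECertificate T g) {v : V}
    (hv : v ∈ G.indepCore \ G.critKer) (huniq : ∀ u ∈ G.indepCore \ G.critKer, u = v) :
    g (f v) = v := by
  have hG : G.IsKonigEgervary := isKonigEgervary_iff_exists_isKECertificate.2 ⟨S, f, h⟩
  have hvcore := (mem_indepCore_iff hG).1 hv.1
  have hvker : ∀ U k, G.IsKECertificate U k → k v ≠ v := fun U k hk hkv =>
    hv.2 ((mem_critKer_iff hG).2 ⟨U, k, hk, hkv⟩)
  have hw : ∀ U k, G.IsKECertificate U k → f v ∉ U := fun U k hk =>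
    (hk.exchange h).apply_notMem (hvcore U k hk) (hvker S f h)
  refine huniq _ ⟨(mem_indepCore_iff hG).2 fun U k hk =>
    (hk.exchange h').apply_mem _ (hw U k hk), fun hker => ?_⟩
  -- A critical independent set avoiding `v` contains `g (f v)`, hence also the `f`-partner `v` of
  -- the neighbor `f v` of `g (f v)`.
  obtain ⟨A, hA, hvA⟩ := h.exists_isCriticalIndepSet_notMem hvker
  refine hvA ?_
  rw [← h.isPairing.involutive v]
  exact (h.fixedPoints_subset_of_isCriticalIndepSet hA).2 _
    ⟨g (f v), h'.adj (hw T g h'), hker A hA⟩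

/-- If `core(G) \ ker(G)` consists of `v` alone, then deleting the edge of a maximum matching at `v`
destroys the König–Egerváry property: the matching number drops, since every maximum matching uses
that edge, while the independence number stays, since `v` lies in the core. -/
theorem IsKECertificate.not_isKonigEgervary_deleteEdges {S : Set V} {f : V → V}
    (h : G.IsKECertificate S f) {v : V}
    (hv : v ∈ G.indepCore \ G.critKer) (huniq : ∀ u ∈ G.indepCore \ G.critKer, u = v) :
    ¬ (G.deleteEdges {s(v, f v)}).IsKonigEgervary := by
  have hG : G.IsKonigEgervary := isKonigEgervary_iff_exists_isKECertificate.2 ⟨S, f, h⟩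
  have hvcore := (mem_indepCore_iff hG).1 hv.1
  rw [isKonigEgervary_iff_exists_isKECertificate]
  rintro ⟨T, g, hT⟩
  have hg : G.IsPairing g := ⟨hT.isPairing.involutive, fun u hu =>
    (deleteEdges_adj.1 (hT.isPairing.adj u hu)).1⟩
  have hgv : g (f v) ≠ v := by
    intro hgv
    have hne : f v ≠ v := fun hfv => hv.2 ((mem_critKer_iff hG).2 ⟨S, f, h, hfv⟩)
    have hadj := hT.isPairing.adj (f v) (hgv.trans_ne hne.symm)
    rw [hgv] at hadj
    exact (deleteEdges_adj.1 hadj).2 Sym2.eq_swap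
  have hlt : (Function.fixedPoints f).ncard < (Function.fixedPoints g).ncard := by
    by_contra! hle
    exact hgv (h.apply_apply_eq_of_forall_eq (h.of_isPairing hg hle) hv huniq)
  have hind : G.IsIndepSet (T \ {v}) := by
    rintro a ⟨ha, hav⟩ b ⟨hb, hbv⟩ hab hadj
    refine hT.isIndepSet ha hb hab (deleteEdges_adj.2 ⟨hadj, fun he => ?_⟩)
    rcases Sym2.eq_iff.1 he with ⟨h1, -⟩ | ⟨-, h1⟩
    · exact hav h1
    · exact hbv h1
  have h1 := h.two_mul_ncard
  have h2 := hT.two_mul_ncard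
  have h3 := Set.pred_ncard_le_ncard_sdiff_singleton T v
  exact (hvcore _ f (h.of_isIndepSet hind (by omega))).2 rfl

/-! ### Counting -/

theorem card_sub_vertexHeredity (hG : G.IsKonigEgervary) :
    (Nat.card V : ℤ) - (G.vertexHeredity : ℤ) = ((G.indepCore \ G.critKer).ncard : ℤ) := by
  have h1 : {v : V | (G.induce ({v}ᶜ : Set V)).IsKonigEgervary} = (G.indepCore \ G.critKer)ᶜ :=
    Set.ext fun _ => isKonigEgervary_induce_compl_iff_notMem hG
  have h2 := Set.ncard_add_ncard_compl (G.indepCore \ G.critKer)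
  rw [vertexHeredity, h1]
  omega

theorem ncard_edgeSet_sub_edgeHeredity (G : SimpleGraph V) :
    (G.edgeSet.ncard : ℤ) - (G.edgeHeredity : ℤ) =
      ({e | e ∈ G.edgeSet ∧ ¬ (G.deleteEdges {e}).IsKonigEgervary}.ncard : ℤ) := by
  have h1 := Set.ncard_inter_add_ncard_sdiff_eq_ncard G.edgeSet
    {e | (G.deleteEdges {e}).IsKonigEgervary}
  change G.edgeHeredity + {e | e ∈ G.edgeSet ∧ ¬ (G.deleteEdges {e}).IsKonigEgervary}.ncard = _
    at h1
  omega

theorem coreCard_sub_kerCard (hG : G.IsKonigEgervary) :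
    (G.coreCard : ℤ) - (G.kerCard : ℤ) = ((G.indepCore \ G.critKer).ncard : ℤ) := by
  have h1 := Set.ncard_sdiff_add_ncard_of_subset (critKer_subset_indepCore hG)
  rw [coreCard, kerCard]
  omega

end SimpleGraph

theorem mainTheorem10 {V : Type*} [Finite V] (G : SimpleGraph V) (hG : G.IsKonigEgervary) :
    (G.edgeSet.ncard : ℤ) - (G.edgeHeredity : ℤ) ≤ (Nat.card V : ℤ) - (G.vertexHeredity : ℤ) ∧
      ((G.coreCard : ℤ) - (G.kerCard : ℤ) ≤ 1 →
        (Nat.card V : ℤ) - (G.vertexHeredity : ℤ) =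
          (G.edgeSet.ncard : ℤ) - (G.edgeHeredity : ℤ)) := by
  obtain ⟨S, f, h⟩ := SimpleGraph.isKonigEgervary_iff_exists_isKECertificate.1 hG
  rw [SimpleGraph.card_sub_vertexHeredity hG, SimpleGraph.ncard_edgeSet_sub_edgeHeredity,
    SimpleGraph.coreCard_sub_kerCard hG]
  have hle := (Set.ncard_le_ncard h.setOf_not_isKonigEgervary_subset).trans (Set.ncard_image_le)
  refine ⟨by exact_mod_cast hle, fun hone => ?_⟩
  have hone' : (G.indepCore \ G.critKer).ncard ≤ 1 := by exact_mod_cast hone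
  refine congrArg _ (le_antisymm ?_ hle)
  rcases Set.eq_empty_or_nonempty (G.indepCore \ G.critKer) with h0 | ⟨v, hv⟩
  · simp [h0]
  · refine hone'.trans ((Set.ncard_pos).2 ⟨s(v, f v), ?_, ?_⟩)
    · refine h.isPairing.adj v fun hfv => hv.2 ?_
      exact (SimpleGraph.mem_critKer_iff hG).2 ⟨S, f, h, hfv⟩
    · exact h.not_isKonigEgervary_deleteEdges hv fun u hu =>
        Set.ncard_le_one_iff_subsingleton.1 hone' hu hv
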